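/- Work on $L^2(\mathbb R)=L^2(\mathbb R;\mathbb C)$ with the unitary Fourier transform $(\mathcal F\varphi)(p)=\int e^{-2\pi i x p}\varphi(x)\,dx$, i.e. with momentum eigenstates $|p\rangle_P=\int e^{2\pi i x p}|x\rangle_X\,dx$. For $f:\mathbb R\to\mathbb C$ the (one-input, one-output) Z spider $Z[f]=\int f(x)\,|x\rangle_X\langle x|_X\,dx$ is multiplication by $f$, with domain $\{\varphi\in L^2: f\varphi\in L^2\}$, and the X spider $X[f]=\int f(p)\,|p\rangle_P\langle p|_P\,dp$ is $\mathcal F^{-1}Z[f]\,\mathcal F$. Let $|n\rangle$ $(n\ge 0)$ be the Fock states in these units, with wave functions $(2\pi)^{1/4}\psi_n(\sqrt{2\pi}\,x)$, where $\psi_n(y)=(2^n n!\sqrt\pi)^{-1/2}H_n(y)e^{-y^2/2}$ is the $n$-th Hermite function. Let $\hat n=\sum_n n\,|n\rangle\langle n|$ and let $$R(\theta)=e^{-i\theta\hat n}=\sum_{n\ge 0}e^{-i\theta n}\,|n\rangle\langle n|$$ be the phase space rotation, i.e. the Fock spider labelled by $n\mapsto e^{-i\theta n}$. Write $q_t(y)=e^{i\pi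 t y^2}$. **Soundness of the Euler rule.** For every $\theta\in(-\pi,\pi)$ the composite $Z[q_{\tan(\theta/2)}]\,X[q_{\sin\theta}]\,Z[q_{\tan(\theta/2)}]$ is defined on all of $L^2(\mathbb R)$, and, as operators with domain all of $L^2(\mathbb R)$, $$R(-\theta)=e^{i\theta\hat n}=e^{-i\theta/2}\;Z[q_{\tan(\theta/2)}]\;X[q_{\sin\theta}]\;Z[q_{\tan(\theta/2)}],$$ $$R(\theta)=e^{-i\theta\hat n}=e^{i\theta/2}\;Z[q_{-\tan(\theta/2)}]\;X[q_{-\sin\theta}]\;Z[q_{-\tan(\theta/2)}].$$ In particular, up to the global phase $e^{\pm i\theta/2}$, the rotation equals the Z–X–Z composite of quadratic-phase spiders with parameters $\pm\tan(\theta/2),\pm\sin\theta,\pm\tan(\theta/2)$. -/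

import Mathlib

open MeasureTheory FourierTransform

/-- The space of one wire, the complex Hilbert space `L²(ℝ)`. -/
abbrev Wire : Type := Lp ℂ 2 (volume : Measure ℝ)

/-- Partially defined linear operators on `L²(ℝ)`, with their domains. -/
abbrev WireOp : Type := Wire →ₗ.[ℂ] Wire

noncomputable section

/-- The composite `g ∘ f` (first `f`, then `g`) of partially defined operators, on its natural
domain `{φ ∈ dom f | f φ ∈ dom g}`. -/
def WireOp.after (g f : WireOp) : WireOp where
  domain := (g.domain.comap f.toFun).map f.domain.subtype
  toFun :=
    { toFun := fun φ =>
        g ⟨f ⟨φ.1, by obtain ⟨_, ⟨y, _, rfl⟩⟩ := φ; exact y.2⟩, by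
          obtain ⟨_, ⟨y, hy, rfl⟩⟩ := φ; exact hy⟩
      map_add' := fun φ χ => by
        rw [← g.map_add]
        congr 1
        apply Subtype.ext
        simp only [Submodule.coe_add]
        rw [← f.map_add]
        rfl
      map_smul' := fun c φ => by
        rw [RingHom.id_apply, ← g.map_smul]
        congr 1
        apply Subtype.ext
        simp only [Submodule.coe_smul]
        rw [← f.map_smul]
        rfl }

/-- The one-input one-output Z spider `∫ f(x) |x⟩⟨x| dx` labelled by an arbitrary function `f`:
multiplication by `f` on the maximal domain `{φ ∈ L² | f φ ∈ L²}`. -/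
def zSpider (f : ℝ → ℂ) : WireOp where
  domain :=
    { carrier := {φ | MemLp (fun x => f x * φ x) 2 volume}
      add_mem' := fun {φ χ} hφ hχ => by
        refine (memLp_congr_ae ?_).2 (MemLp.add hφ hχ)
        filter_upwards [Lp.coeFn_add φ χ] with x hx
        rw [Pi.add_apply, hx, Pi.add_apply, mul_add]
      zero_mem' := by
        refine (memLp_congr_ae ?_).2 (MemLp.zero (ε := ℂ) (p := 2) (μ := (volume : Measure ℝ)))
        filter_upwards [Lp.coeFn_zero ℂ 2 (volume : Measure ℝ)] with x hx
        simp
      smul_mem' := fun c φ hφ => by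
        refine (memLp_congr_ae ?_).2 (MemLp.const_smul hφ c)
        filter_upwards [Lp.coeFn_smul c φ] with x hx
        simp [hx, mul_left_comm] }
  toFun :=
    { toFun := fun φ => MemLp.toLp (fun x => f x * (φ : Wire) x) φ.2
      map_add' := fun φ χ => by
        rw [← MemLp.toLp_add]
        refine MemLp.toLp_congr _ _ ?_
        filter_upwards [Lp.coeFn_add (φ : Wire) (χ : Wire)] with x hx
        rw [Pi.add_apply, Submodule.coe_add, hx, Pi.add_apply, mul_add]
      map_smul' := fun c φ => by
        rw [RingHom.id_apply, ← MemLp.toLp_const_smul]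
        refine MemLp.toLp_congr _ _ ?_
        filter_upwards [Lp.coeFn_smul c (φ : Wire)] with x hx
        simp [hx, mul_left_comm] }

/-- The one-input one-output X spider `∫ f(p) |p⟩⟨p| dp`, where `|p⟩ = ∫ exp(2πixp) |x⟩ dx`:
the multiplication operator by `f` conjugated by the unitary Fourier transform
`(𝓕 φ)(p) = ⟨p|φ⟩ = ∫ exp(-2πixp) φ(x) dx`. -/
def xSpider (f : ℝ → ℂ) : WireOp :=
  let F : Wire →ₗ[ℂ] Wire := (Lp.fourierTransformₗᵢ ℝ ℂ).toLinearEquiv.toLinearMap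
  let Finv : Wire →ₗ[ℂ] Wire := (Lp.fourierTransformₗᵢ ℝ ℂ).symm.toLinearEquiv.toLinearMap
  Finv.compPMap (WireOp.after (zSpider f) (F.toPMap ⊤))

/-- The (physicists') Hermite polynomials: `H₀ = 1`, `H₁ = 2y`, `Hₙ = 2y Hₙ₋₁ - 2(n-1) Hₙ₋₂`. -/
def hermiteH : ℕ → Polynomial ℝ
  | 0 => 1
  | 1 => 2 * Polynomial.X
  | n + 2 => 2 * Polynomial.X * hermiteH (n + 1)
      - Polynomial.C (2 * ((n : ℝ) + 1)) * hermiteH n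

/-- The Hermite functions `ψₙ(y) = (2ⁿ n! √π)^(-1/2) Hₙ(y) exp(-y²/2)`. -/
def hermitePsi (n : ℕ) (y : ℝ) : ℝ :=
  (Real.sqrt (2 ^ n * (n.factorial : ℝ) * Real.sqrt Real.pi))⁻¹
    * (hermiteH n).eval y * Real.exp (-y ^ 2 / 2)

/-- The position wave function `(2π)^(1/4) ψₙ(√(2π) x)` of the `n`-th Fock state, in the units in
which the Fourier transform has kernel `exp(-2πixp)`; for instance the vacuum is
`2^(1/4) exp(-πx²)`, and the Fourier transform is the Fock-diagonal operator `(-i)ⁿ`. -/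
def fockWave (n : ℕ) (x : ℝ) : ℝ :=
  Real.sqrt (Real.sqrt (2 * Real.pi)) * hermitePsi n (Real.sqrt (2 * Real.pi) * x)

theorem memLp_polynomial_mul_gaussian (c : ℝ) (q : Polynomial ℝ) :
    MemLp (fun x : ℝ => q.eval (c * x) * Real.exp (-Real.pi * x ^ 2)) 2 volume := by
  induction q using Polynomial.induction_on' with
  | add p q hp hq =>
    refine (memLp_congr_ae (Filter.Eventually.of_forall fun x => ?_)).2 (hp.add hq)
    simp [add_mul]
  | monomial k a =>
    have hc : Continuous fun x : ℝ =>
        (Polynomial.monomial k a).eval (c * x) * Real.exp (-Real.pi * x ^ 2) := by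
      fun_prop
    rw [memLp_two_iff_integrable_sq hc.aestronglyMeasurable]
    have h := (integrable_rpow_mul_exp_neg_mul_sq (b := 2 * Real.pi) (by positivity)
      (s := ((2 * k : ℕ) : ℝ)) (by
        have : (0 : ℝ) ≤ ((2 * k : ℕ) : ℝ) := Nat.cast_nonneg _
        linarith)).const_mul ((a * c ^ k) ^ 2)
    refine h.congr (Filter.Eventually.of_forall fun x => ?_)
    have e : Real.exp (-(2 * Real.pi) * x ^ 2) = Real.exp (-Real.pi * x ^ 2) ^ 2 := by
      rw [← Real.exp_nat_mul]
      congr 1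
      push_cast
      ring
    simp only [Real.rpow_natCast, Polynomial.eval_monomial, e]
    ring

theorem memLp_fockWave (n : ℕ) : MemLp (fun x : ℝ => (fockWave n x : ℂ)) 2 volume := by
  have h := ((memLp_polynomial_mul_gaussian (Real.sqrt (2 * Real.pi)) (hermiteH n)).const_mul
    (Real.sqrt (Real.sqrt (2 * Real.pi))
      * (Real.sqrt (2 ^ n * (n.factorial : ℝ) * Real.sqrt Real.pi))⁻¹)).ofReal (K := ℂ)
  refine (memLp_congr_ae (Filter.Eventually.of_forall fun x => ?_)).2 h
  have e : -(Real.sqrt (2 * Real.pi) * x) ^ 2 / 2 = -Real.pi * x ^ 2 := by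
    rw [mul_pow, Real.sq_sqrt (by positivity)]
    ring
  simp only [fockWave, hermitePsi, e]
  push_cast
  simp only [Complex.coe_algebraMap]
  push_cast
  ring

/-- The Fock state `|n⟩`. -/
def fockState (n : ℕ) : Wire := (memLp_fockWave n).toLp _

/-- The one-input one-output Fock spider `∑ₙ g(n) |n⟩⟨n|` labelled by an arbitrary function `g`,
on the domain of the states at which the series converges in `L²(ℝ)`. As `|n⟩` is the eigenstate
of the number operator `n̂ = ∑ₙ n |n⟩⟨n|` with eigenvalue `n`, this is the operator `g(n̂)`. -/
def fockSpider (g : ℕ → ℂ) : WireOp where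
  domain :=
    { carrier := {φ | Summable fun n => (g n * inner ℂ (fockState n) φ) • fockState n}
      add_mem' := fun {φ χ} hφ hχ => by
        refine (Summable.add hφ hχ).congr fun n => ?_
        rw [inner_add_right, mul_add, add_smul]
      zero_mem' := by
        simp
      smul_mem' := fun c φ hφ => by
        refine (Summable.const_smul c hφ).congr fun n => ?_
        rw [inner_smul_right, smul_smul, mul_left_comm] }
  toFun :=
    { toFun := fun φ => ∑' n, (g n * inner ℂ (fockState n) (φ : Wire)) • fockState n
      map_add' := fun φ χ => by
        rw [← Summable.tsum_add φ.2 χ.2]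
        refine tsum_congr fun n => ?_
        rw [Submodule.coe_add, inner_add_right, mul_add, add_smul]
      map_smul' := fun c φ => by
        rw [RingHom.id_apply, ← Summable.tsum_const_smul c φ.2]
        refine tsum_congr fun n => ?_
        rw [Submodule.coe_smul, inner_smul_right, smul_smul, mul_left_comm] }

/-- The phase space rotation `R(θ) = exp(-iθ n̂)`, where `n̂ = ∑ₙ n |n⟩⟨n|`. -/
def phaseRotation (θ : ℝ) : WireOp :=
  fockSpider fun n => Complex.exp (-(Complex.I * θ * n))

/-- The quadratic phase `y ↦ exp(iπ t y²)` with parameter `t`. -/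
def quadPhase (t : ℝ) (y : ℝ) : ℂ :=
  Complex.exp (Complex.I * Real.pi * t * y ^ 2)

/-- The composite of a Z, an X and a Z spider labelled by quadratic phases with parameters
`a`, `b`, `c`. -/
def zxzComposite (a b c : ℝ) : WireOp :=
  (zSpider (quadPhase a)).after ((xSpider (quadPhase b)).after (zSpider (quadPhase c)))

end

/-! ### Gaussians and the Fourier transform on `L²(ℝ)`. -/

open Polynomial

/-! Both sides act simply on the coherent states `coherentState w`. Quadratic phases and Fourier
transforms map Gaussians to Gaussians, and tracking width, linear coefficient and scalar shows that
the composite sends parameter `w` to `exp(iθ) w` with factor `exp(iθ/2)` (`zxzCLM_coherentState`).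
The `n`-th Fock coefficient of a coherent state is a constant times `w ^ n`
(`inner_fockState_coherentState`), so this is multiplication of that coefficient by `exp(iθn)`.

Coherent states with imaginary parameter have dense span, by injectivity of the Fourier transform
(`eq_zero_of_inner_coherentState_eq_zero`). As the composite is bounded, the coefficient identity
extends to every state. The Fock states are orthonormal by Gaussian integration by parts, and
complete because Parseval's identity holds on these coherent states (`fockBasis`). Expanding the
composite in this basis gives the rotation, with full domain. -/

/-- `L²` embeds injectively into tempered distributions, where both transforms can be moved onto the
test function. This links the abstract unitary to the Fourier integral. -/
theorem toLp_fourier_of_integrable {f : ℝ → ℂ} (hf : Integrable f) (hf2 : MemLp f 2 volume)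
    (hF : MemLp (𝓕 f) 2 volume) :
    Lp.fourierTransformₗᵢ ℝ ℂ (hf2.toLp f) = hF.toLp (𝓕 f) := by
  change 𝓕 (hf2.toLp f) = _
  have hinj : Function.Injective (Lp.toTemperedDistributionCLM (E := ℝ) ℂ volume 2) := by
    refine LinearMap.ker_eq_bot.1 ?_
    exact Lp.ker_toTemperedDistributionCLM_eq_bot
  apply hinj
  rw [Lp.toTemperedDistributionCLM_apply, Lp.toTemperedDistributionCLM_apply,
    ← Lp.fourier_toTemperedDistribution_eq]
  ext g
  rw [TemperedDistribution.fourier_apply, Lp.toTemperedDistribution_apply,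
    Lp.toTemperedDistribution_apply]
  have h1 : ∫ x, (𝓕 g) x • (hf2.toLp f : ℝ → ℂ) x = ∫ x, (𝓕 (g : ℝ → ℂ)) x • f x := by
    refine integral_congr_ae ?_
    filter_upwards [hf2.coeFn_toLp] with x hx
    rw [hx, SchwartzMap.fourier_coe]
  have h2 : ∫ x, g x • (hF.toLp (𝓕 f) : ℝ → ℂ) x = ∫ x, g x • (𝓕 f) x := by
    refine integral_congr_ae ?_
    filter_upwards [hF.coeFn_toLp] with x hx
    rw [hx]
  rw [h1, h2]
  simpa using! VectorFourier.integral_fourierIntegral_smul_eq_flip (L := innerₗ ℝ)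
      Real.continuous_fourierChar continuous_inner g.integrable hf

theorem inner_toLp_toLp {f g : ℝ → ℂ} (hf : MemLp f 2 volume) (hg : MemLp g 2 volume) :
    inner ℂ (hf.toLp f) (hg.toLp g) = ∫ x, starRingEnd ℂ (f x) * g x := by
  rw [L2.inner_def]
  refine integral_congr_ae ?_
  filter_upwards [hf.coeFn_toLp, hg.coeFn_toLp] with x h1 h2
  rw [h1, h2, RCLike.inner_apply, mul_comm]

noncomputable section

/-- The Gaussian `x ↦ exp(-π b x² + 2π w x)`. -/
def gaussian (b w : ℂ) (x : ℝ) : ℂ :=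
  Complex.exp (-Real.pi * b * x ^ 2 + 2 * Real.pi * w * x)

theorem continuous_gaussian (b w : ℂ) : Continuous (gaussian b w) := by
  unfold gaussian
  fun_prop

theorem gaussian_mul_gaussian (b b' w w' : ℂ) (x : ℝ) :
    gaussian b w x * gaussian b' w' x = gaussian (b + b') (w + w') x := by
  rw [gaussian, gaussian, gaussian, ← Complex.exp_add]
  congr 1
  ring

theorem conj_gaussian (b w : ℂ) (x : ℝ) :
    starRingEnd ℂ (gaussian b w x) = gaussian (starRingEnd ℂ b) (starRingEnd ℂ w) x := by
  rw [gaussian, gaussian, ← Complex.exp_conj]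
  simp [map_ofNat]

theorem integrable_gaussian {b : ℂ} (hb : 0 < b.re) (w : ℂ) : Integrable (gaussian b w) := by
  have h := integrable_cexp_quadratic (b := Real.pi * b)
    (by simpa using mul_pos Real.pi_pos hb) (2 * Real.pi * w) 0
  refine h.congr (Filter.Eventually.of_forall fun x => ?_)
  simp [gaussian]

theorem integral_gaussian_quadratic {b : ℂ} (hb : 0 < b.re) (w : ℂ) :
    ∫ x, gaussian b w x = 1 / b ^ (1 / 2 : ℂ) * Complex.exp (Real.pi * w ^ 2 / b) := by
  have h := congrFun (fourier_gaussian_pi' hb w) 0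
  rw [Real.fourier_eq'] at h
  simp only [mul_zero, inner_zero_right, Complex.ofReal_zero, zero_mul, Complex.exp_zero,
    one_smul, zero_add] at h
  refine Eq.trans ?_ (h.trans ?_)
  · rfl
  · congr 2
    rw [mul_pow, Complex.I_sq]
    ring

theorem memLp_gaussian {b : ℂ} (hb : 0 < b.re) (w : ℂ) : MemLp (gaussian b w) 2 volume := by
  rw [memLp_two_iff_integrable_sq_norm (continuous_gaussian b w).aestronglyMeasurable]
  refine ((integrable_gaussian (b := b + b) (by simpa using hb) (w + w)).norm).congr
    (Filter.Eventually.of_forall fun x => ?_)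
  simp only
  rw [← gaussian_mul_gaussian, norm_mul, sq]

theorem fourier_gaussian_eq {b : ℂ} (hb : 0 < b.re) (w : ℂ) :
    𝓕 (gaussian b w) = fun p => (1 / b ^ (1 / 2 : ℂ) * Complex.exp (Real.pi * w ^ 2 / b)) *
      gaussian b⁻¹ (-(Complex.I * w / b)) p := by
  have h := fourier_gaussian_pi' hb w
  refine Eq.trans rfl (h.trans ?_)
  funext p
  rw [gaussian, mul_assoc, ← Complex.exp_add]
  congr 2
  have hb0 : b ≠ 0 := by rintro rfl; simp at hb
  field_simp
  linear_combination (-w ^ 2) * Complex.I_sq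

theorem inv_re_pos {b : ℂ} (hb : 0 < b.re) : 0 < b⁻¹.re := by
  rw [Complex.inv_re]
  exact div_pos hb (Complex.normSq_pos.2 (by rintro rfl; simp at hb))

/-- The `L²` class of the Gaussian `x ↦ exp(-π b x² + 2π w x)`. -/
def gaussianState {b : ℂ} (hb : 0 < b.re) (w : ℂ) : Wire := (memLp_gaussian hb w).toLp _

theorem gaussianState_congr {b b' w w' : ℂ} (hb : 0 < b.re) (hb' : 0 < b'.re) (h : b = b')
    (hw : w = w') : gaussianState hb w = gaussianState hb' w' := by
  subst h hw
  rfl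

theorem fourier_gaussianState {b : ℂ} (hb : 0 < b.re) (w : ℂ) :
    Lp.fourierTransformₗᵢ ℝ ℂ (gaussianState hb w) =
      (1 / b ^ (1 / 2 : ℂ) * Complex.exp (Real.pi * w ^ 2 / b)) •
        gaussianState (inv_re_pos hb) (-(Complex.I * w / b)) := by
  have hF : MemLp (𝓕 (gaussian b w)) 2 volume := by
    rw [fourier_gaussian_eq hb]
    exact (memLp_gaussian (inv_re_pos hb) _).const_mul _
  rw [gaussianState, toLp_fourier_of_integrable (integrable_gaussian hb w) _ hF, gaussianState,
    ← MemLp.toLp_const_smul]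
  exact MemLp.toLp_congr _ _ (Filter.Eventually.of_forall fun x => congrFun
    (fourier_gaussian_eq hb w) x)

/-- Checked by applying the forward transform at width `b⁻¹`. Keeping the root of `b⁻¹` in the
scalar avoids any comparison of branches here. -/
theorem fourier_symm_gaussianState {b : ℂ} (hb : 0 < b.re) (w : ℂ) :
    (Lp.fourierTransformₗᵢ ℝ ℂ).symm (gaussianState hb w) =
      (b⁻¹ ^ (1 / 2 : ℂ) * Complex.exp (Real.pi * w ^ 2 / b)) •
        gaussianState (inv_re_pos hb) (Complex.I * w / b) := by
  have hb0 : b ≠ 0 := by rintro rfl; simp at hb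
  rw [LinearIsometryEquiv.symm_apply_eq, map_smul, fourier_gaussianState, smul_smul]
  rw [gaussianState_congr _ hb (inv_inv b) (w' := w) (by
    field_simp
    linear_combination (-w) * Complex.I_sq)]
  have h : Real.pi * (Complex.I * w / b) ^ 2 / b⁻¹ = -(Real.pi * w ^ 2 / b) := by
    field_simp
    linear_combination (w ^ 2) * Complex.I_sq
  have hne : b⁻¹ ^ (1 / 2 : ℂ) ≠ 0 := by
    rw [Complex.cpow_def_of_ne_zero (inv_ne_zero hb0)]
    exact Complex.exp_ne_zero _
  rw [h, Complex.exp_neg]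
  have he := Complex.exp_ne_zero (Real.pi * w ^ 2 / b)
  generalize b⁻¹ ^ (1 / 2 : ℂ) = β at hne ⊢
  rw [show (β * Complex.exp (Real.pi * w ^ 2 / b)) *
    (1 / β * (Complex.exp (Real.pi * w ^ 2 / b))⁻¹) = 1 by field_simp, one_smul]

end

/-! ### Quadratic-phase spiders and their composite as bounded operators. -/

theorem WireOp.mem_domain_after {g f : WireOp} {φ : Wire} :
    φ ∈ (g.after f).domain ↔ ∃ h : φ ∈ f.domain, f ⟨φ, h⟩ ∈ g.domain := by
  constructor
  · rintro ⟨y, hy, rfl⟩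
    exact ⟨y.2, hy⟩
  · rintro ⟨h, hg⟩
    exact ⟨⟨φ, h⟩, hg, rfl⟩

theorem norm_quadPhase (t y : ℝ) : ‖quadPhase t y‖ = 1 := by
  rw [quadPhase, show Complex.I * Real.pi * t * (y : ℂ) ^ 2 = ((Real.pi * t * y ^ 2 : ℝ) : ℂ) *
    Complex.I by push_cast; ring]
  exact Complex.norm_exp_ofReal_mul_I _

theorem continuous_quadPhase (t : ℝ) : Continuous (quadPhase t) := by
  unfold quadPhase
  fun_prop

theorem quadPhase_mul_gaussian (t : ℝ) (b w : ℂ) (x : ℝ) :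
    quadPhase t x * gaussian b w x = gaussian (b - Complex.I * t) w x := by
  rw [quadPhase, gaussian, gaussian, ← Complex.exp_add]
  congr 1
  ring

theorem zSpider_quadPhase_domain (t : ℝ) : (zSpider (quadPhase t)).domain = ⊤ := by
  refine eq_top_iff.2 fun φ _ => ?_
  change MemLp (fun x => quadPhase t x * φ x) 2 volume
  refine (Lp.memLp φ).of_le
    ((continuous_quadPhase t).aestronglyMeasurable.mul (Lp.aestronglyMeasurable φ))
    (Filter.Eventually.of_forall fun x => ?_)
  rw [norm_mul, norm_quadPhase, one_mul]

noncomputable section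

/-- Multiplication by the quadratic phase with parameter `t`, as a bounded operator. -/
def quadPhaseCLM (t : ℝ) : Wire →L[ℂ] Wire :=
  LinearMap.mkContinuous
    { toFun := fun φ => zSpider (quadPhase t) ⟨φ, by rw [zSpider_quadPhase_domain]; trivial⟩
      map_add' := fun φ χ => by rw [← LinearPMap.map_add]; rfl
      map_smul' := fun c φ => by rw [← LinearPMap.map_smul]; rfl } 1 fun φ => by
    rw [one_mul]
    refine Lp.norm_le_norm_of_ae_le ?_
    have h : MemLp (fun x => quadPhase t x * φ x) 2 volume := by
      change φ ∈ (zSpider (quadPhase t)).domain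
      rw [zSpider_quadPhase_domain]
      trivial
    filter_upwards [h.coeFn_toLp] with x hx
    change ‖h.toLp _ x‖ ≤ _
    rw [hx, norm_mul, norm_quadPhase, one_mul]

theorem quadPhaseCLM_gaussianState (t : ℝ) {b : ℂ} (hb : 0 < b.re) (w : ℂ)
    (hb' : 0 < (b - Complex.I * t).re) :
    quadPhaseCLM t (gaussianState hb w) = gaussianState hb' w := by
  have h : MemLp (fun x => quadPhase t x * gaussianState hb w x) 2 volume := by
    change gaussianState hb w ∈ (zSpider (quadPhase t)).domain
    rw [zSpider_quadPhase_domain]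
    trivial
  refine MemLp.toLp_congr h (memLp_gaussian hb' w) ?_
  filter_upwards [(memLp_gaussian hb w).coeFn_toLp] with x hx
  rw [← quadPhase_mul_gaussian, gaussianState]
  simp only [hx]

theorem xSpider_quadPhase_domain (t : ℝ) : (xSpider (quadPhase t)).domain = ⊤ := by
  refine eq_top_iff.2 fun φ _ => ?_
  refine WireOp.mem_domain_after.2 ⟨trivial, ?_⟩
  rw [zSpider_quadPhase_domain]
  trivial

/-- The composite of Z, X and Z spiders with quadratic phases, as a bounded operator. -/
def zxzCLM (a b c : ℝ) : Wire →L[ℂ] Wire :=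
  quadPhaseCLM a ∘L
    ((Lp.fourierTransformₗᵢ ℝ ℂ).symm.toContinuousLinearEquiv : Wire →L[ℂ] Wire) ∘L
    quadPhaseCLM b ∘L ((Lp.fourierTransformₗᵢ ℝ ℂ).toContinuousLinearEquiv : Wire →L[ℂ] Wire) ∘L
    quadPhaseCLM c

theorem zxzCLM_apply (a b c : ℝ) (φ : Wire) :
    zxzCLM a b c φ = quadPhaseCLM a ((Lp.fourierTransformₗᵢ ℝ ℂ).symm
      (quadPhaseCLM b (Lp.fourierTransformₗᵢ ℝ ℂ (quadPhaseCLM c φ)))) :=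
  rfl

theorem zxzComposite_domain (a b c : ℝ) : (zxzComposite a b c).domain = ⊤ := by
  refine eq_top_iff.2 fun φ _ => ?_
  refine WireOp.mem_domain_after.2 ⟨WireOp.mem_domain_after.2 ⟨?_, ?_⟩, ?_⟩
  · rw [zSpider_quadPhase_domain]; trivial
  · rw [xSpider_quadPhase_domain]; trivial
  · rw [zSpider_quadPhase_domain]; trivial

theorem zxzComposite_apply (a b c : ℝ) (φ : (zxzComposite a b c).domain) :
    zxzComposite a b c φ = zxzCLM a b c φ :=
  rfl

/-- The unnormalised coherent state `exp(-π w²/2) exp(-π x² + 2π w x)`. -/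
def coherentState (w : ℂ) : Wire :=
  Complex.exp (-(Real.pi * w ^ 2 / 2)) • gaussianState (b := 1) (by simp) w

end

/-! ### Action of the composite on coherent states. -/

theorem exp_cpow_half {z : ℂ} (h1 : -Real.pi < z.im) (h2 : z.im ≤ Real.pi) :
    Complex.exp z ^ (1 / 2 : ℂ) = Complex.exp (z / 2) := by
  rw [Complex.cpow_def_of_ne_zero (Complex.exp_ne_zero z), Complex.log_exp h1 h2]
  congr 1
  ring

/-- With `u = exp(iθ/2)` and `c = cos(θ/2)`, the width runs through `1`, `u⁻¹/c`, `u c`, `u⁻¹ c`,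
`u/c`, `1`: phases subtract `i` times their parameter, Fourier transforms invert. The three
parameters are what closes this loop. -/
theorem zxzCLM_coherentState {θ : ℝ} (hθ : θ ∈ Set.Ioo (-Real.pi) Real.pi) (w : ℂ) :
    zxzCLM (Real.tan (θ / 2)) (Real.sin θ) (Real.tan (θ / 2)) (coherentState w) =
      Complex.exp (Complex.I * θ / 2) • coherentState (Complex.exp (Complex.I * θ) * w) := by
  have hc : 0 < Real.cos (θ / 2) :=
    Real.cos_pos_of_mem_Ioo ⟨by linarith [hθ.1], by linarith [hθ.2]⟩
  set c : ℂ := (Real.cos (θ / 2) : ℂ) with hcdef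
  set s : ℂ := (Real.sin (θ / 2) : ℂ) with hsdef
  have hc0 : c ≠ 0 := by rw [hcdef]; exact_mod_cast hc.ne'
  set u : ℂ := Complex.exp (Complex.I * θ / 2) with hu
  have hu0 : u ≠ 0 := Complex.exp_ne_zero _
  have hus : u = c + s * Complex.I := by
    rw [hu, hcdef, hsdef, Complex.ofReal_cos, Complex.ofReal_sin, ← Complex.exp_mul_I]
    congr 1
    push_cast
    ring
  have hui : u⁻¹ = c - s * Complex.I := by
    rw [hu, ← Complex.exp_neg, hcdef, hsdef, Complex.ofReal_cos, Complex.ofReal_sin,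
      show -(Complex.I * θ / 2) = -(((θ / 2 : ℝ) : ℂ)) * Complex.I by push_cast; ring,
      Complex.exp_mul_I, Complex.cos_neg, Complex.sin_neg]
    ring
  have hu2 : Complex.exp (Complex.I * θ) = u ^ 2 := by
    rw [hu, ← Complex.exp_nat_mul]
    congr 1
    push_cast
    ring
  have ht : ((Real.tan (θ / 2) : ℝ) : ℂ) = s / c := by
    rw [Real.tan_eq_sin_div_cos, Complex.ofReal_div]
  have hs : ((Real.sin θ : ℝ) : ℂ) = 2 * s * c := by
    rw [hcdef, hsdef]
    exact_mod_cast (congrArg Real.sin (show θ = 2 * (θ / 2) by ring)).trans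
      (Real.sin_two_mul _)
  have hb1 : (1 : ℂ) - Complex.I * (Real.tan (θ / 2) : ℝ) = u⁻¹ / c := by
    rw [ht, hui]
    field_simp
  have hb1i : ((1 : ℂ) - Complex.I * (Real.tan (θ / 2) : ℝ))⁻¹ = u * c := by
    rw [hb1]
    field_simp
  have hb2 : ((1 : ℂ) - Complex.I * (Real.tan (θ / 2) : ℝ))⁻¹ - Complex.I * (Real.sin θ : ℝ)
      = u⁻¹ * c := by
    rw [hb1i, hs, hui, hus]
    ring
  have hb2i : (((1 : ℂ) - Complex.I * (Real.tan (θ / 2) : ℝ))⁻¹ -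
      Complex.I * (Real.sin θ : ℝ))⁻¹ = u / c := by
    rw [hb2]
    field_simp
  have hb3 : (((1 : ℂ) - Complex.I * (Real.tan (θ / 2) : ℝ))⁻¹ -
      Complex.I * (Real.sin θ : ℝ))⁻¹ - Complex.I * (Real.tan (θ / 2) : ℝ) = 1 := by
    rw [hb2i, ht, hus]
    field_simp
    ring
  have p1 : 0 < ((1 : ℂ) - Complex.I * (Real.tan (θ / 2) : ℝ)).re := by
    rw [Complex.sub_re, Complex.I_mul_re, Complex.ofReal_im]
    simp
  have p2 : 0 < (((1 : ℂ) - Complex.I * (Real.tan (θ / 2) : ℝ))⁻¹ -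
      Complex.I * (Real.sin θ : ℝ)).re := by
    have := inv_re_pos p1
    simpa using this
  have p3 : 0 < ((((1 : ℂ) - Complex.I * (Real.tan (θ / 2) : ℝ))⁻¹ -
      Complex.I * (Real.sin θ : ℝ))⁻¹ - Complex.I * (Real.tan (θ / 2) : ℝ)).re := by
    rw [hb3]; simp
  rw [zxzCLM_apply, coherentState, map_smul, quadPhaseCLM_gaussianState _ _ _ p1, map_smul,
    fourier_gaussianState]
  simp only [map_smul]
  rw [quadPhaseCLM_gaussianState _ _ _ p2, fourier_symm_gaussianState]
  simp only [map_smul]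
  -- The two transforms multiply the linear coefficient by `-i/(u⁻¹/c)` and `i/(u⁻¹ c)`, whose
  -- product is `u ^ 2`.
  rw [quadPhaseCLM_gaussianState _ _ _ p3,
    gaussianState_congr p3 (b' := 1) (by simp) hb3 (w' := u ^ 2 * w) (by
      rw [hb2, hb1]
      field_simp
      linear_combination (-w) * Complex.I_sq), coherentState, hu2,
    smul_smul, smul_smul, smul_smul]
  congr 1
  rw [hb2i, hb2, hb1]
  have hr : (Real.exp (Real.log (Real.cos (θ / 2))) : ℂ) = c := by rw [Real.exp_log hc]
  -- Polar forms with modulus `1/c` and arguments `∓θ/2`, to evaluate the principal square roots.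
  have e1 : u⁻¹ / c =
      Complex.exp ((-Real.log (Real.cos (θ / 2)) : ℝ) + (-(θ / 2) : ℝ) * Complex.I) := by
    rw [Complex.exp_add, ← Complex.ofReal_exp, Real.exp_neg, Complex.ofReal_inv, hr, hu,
      ← Complex.exp_neg, div_eq_inv_mul]
    congr 2
    push_cast
    ring
  have e2 : u / c =
      Complex.exp ((-Real.log (Real.cos (θ / 2)) : ℝ) + (θ / 2 : ℝ) * Complex.I) := by
    rw [Complex.exp_add, ← Complex.ofReal_exp, Real.exp_neg, Complex.ofReal_inv, hr, hu,
      div_eq_inv_mul]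
    congr 2
    push_cast
    ring
  -- The ratio of the two Fourier prefactors is the global phase `u`; it has no sign ambiguity
  -- because both arguments lie in `(-π/2, π/2)`.
  have e3 : (u / c) ^ (1 / 2 : ℂ) = u * (u⁻¹ / c) ^ (1 / 2 : ℂ) := by
    rw [e1, e2, exp_cpow_half, exp_cpow_half, hu, ← Complex.exp_add]
    · congr 1
      push_cast
      ring
    all_goals simp
    all_goals linarith [hθ.1, hθ.2]
  have e4 : (u⁻¹ / c) ^ (1 / 2 : ℂ) ≠ 0 := by
    rw [e1, Complex.cpow_def_of_ne_zero (Complex.exp_ne_zero _)]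
    exact Complex.exp_ne_zero _
  rw [e3]
  -- With `2c = u + u⁻¹`, the exponents add up through `-1/2 + u c - u ^ 3 c = -u ^ 4 / 2`.
  have e5 : Complex.exp (-(Real.pi * w ^ 2 / 2)) * Complex.exp (Real.pi * w ^ 2 / (u⁻¹ / c)) *
      Complex.exp (Real.pi * (-(Complex.I * w / (u⁻¹ / c))) ^ 2 / (u⁻¹ * c)) =
      Complex.exp (-(Real.pi * (u ^ 2 * w) ^ 2 / 2)) := by
    rw [← Complex.exp_add, ← Complex.exp_add]
    congr 1
    have h2c : 2 * c = u + u⁻¹ := by rw [hui, hus]; ring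
    have hc' : c = (u + u⁻¹) / 2 := by rw [← h2c]; ring
    have : Real.pi * (-(Complex.I * w / (u⁻¹ / c))) ^ 2 / (u⁻¹ * c) = - (Real.pi * w ^ 2 * u ^ 3 * c) := by
      field_simp
      linear_combination (w ^ 2) * Complex.I_sq
    rw [this]
    have : Real.pi * w ^ 2 / (u⁻¹ / c) = Real.pi * w ^ 2 * u * c := by field_simp
    rw [this, hc']
    field_simp
    ring
  rw [← e5]
  field_simp

/-! ### Hermite polynomials and their Gaussian moments. -/

theorem derivative_hermiteH_succ (n : ℕ) :
    derivative (hermiteH (n + 1)) = C (2 * ((n : ℝ) + 1)) * hermiteH n ∧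
      hermiteH (n + 2) = 2 * X * hermiteH (n + 1) - derivative (hermiteH (n + 1)) := by
  have key : derivative (hermiteH (n + 1)) = C (2 * ((n : ℝ) + 1)) * hermiteH n := by
    induction n using Nat.twoStepInduction with
    | zero => simp [hermiteH, C_ofNat]
    | one =>
      simp [hermiteH]
      simp only [C_ofNat]
      ring
    | more n h0 h1 =>
      rw [hermiteH]
      simp only [derivative_sub, derivative_mul, derivative_C, derivative_X, h1, h0,
        derivative_ofNat, zero_mul, mul_one, zero_add]
      rw [show hermiteH (n + 2) = 2 * X * hermiteH (n + 1)
        - C (2 * ((n : ℝ) + 1)) * hermiteH n from rfl]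
      push_cast
      simp only [C_mul, C_add, C_1, C_ofNat]
      ring
  exact ⟨key, by rw [key]; rfl⟩

theorem hermiteH_succ_eq (n : ℕ) :
    hermiteH (n + 1) = 2 * X * hermiteH n - derivative (hermiteH n) := by
  cases n with
  | zero => simp [hermiteH]
  | succ n => exact (derivative_hermiteH_succ n).2

noncomputable section

/-- The scale `√(2π)` between position and the argument of the Hermite polynomials. -/
def hermiteScale : ℝ := Real.sqrt (2 * Real.pi)

theorem hermiteScale_pos : 0 < hermiteScale := Real.sqrt_pos.2 (by positivity)

theorem hermiteScale_sq : hermiteScale ^ 2 = 2 * Real.pi := Real.sq_sqrt (by positivity)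

theorem hermiteScale_sq_complex : (hermiteScale : ℂ) ^ 2 = 2 * Real.pi := by
  exact_mod_cast hermiteScale_sq

theorem ofReal_exp_neg_pi (x : ℝ) : (Real.exp (-Real.pi * x ^ 2) : ℂ) = gaussian 1 0 x := by
  rw [gaussian]
  push_cast
  congr 1
  ring

theorem integrable_polynomial_mul_gaussian (P : ℝ[X]) (w : ℂ) :
    Integrable fun x : ℝ => ((P.eval (hermiteScale * x) : ℝ) : ℂ) * gaussian 2 w x := by
  have h := (memLp_polynomial_mul_gaussian hermiteScale P).ofReal (K := ℂ)
  refine (h.integrable_mul (memLp_gaussian (b := 1) (by simp) w)).congr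
    (Filter.Eventually.of_forall fun x => ?_)
  simp only [Pi.mul_apply, Complex.coe_algebraMap, Complex.ofReal_mul, ofReal_exp_neg_pi]
  rw [mul_assoc, gaussian_mul_gaussian, zero_add, one_add_one_eq_two]

/-- The integral of a rescaled polynomial against the Gaussian `exp(-2π x² + 2π w x)`. -/
def gaussianMoment (w : ℂ) : ℝ[X] →ₗ[ℝ] ℂ where
  toFun P := ∫ x : ℝ, ((P.eval (hermiteScale * x) : ℝ) : ℂ) * gaussian 2 w x
  map_add' P Q := by
    rw [← integral_add (integrable_polynomial_mul_gaussian P w)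
      (integrable_polynomial_mul_gaussian Q w)]
    simp only [eval_add, Complex.ofReal_add, add_mul]
  map_smul' a P := by
    rw [RingHom.id_apply, ← integral_smul]
    simp only [eval_smul, smul_eq_mul, Complex.ofReal_mul, Complex.real_smul, mul_assoc]

theorem gaussianMoment_apply (w : ℂ) (P : ℝ[X]) : gaussianMoment w P =
    ∫ x : ℝ, ((P.eval (hermiteScale * x) : ℝ) : ℂ) * gaussian 2 w x :=
  rfl

theorem hasDerivAt_gaussian (b w : ℂ) (x : ℝ) :
    HasDerivAt (gaussian b w) ((-(2 * Real.pi * b * x) + 2 * Real.pi * w) * gaussian b w x) x := by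
  have h1 : HasDerivAt (fun x : ℝ => (x : ℂ)) 1 x := Complex.ofRealCLM.hasDerivAt
  have h2 := (((h1.pow 2).const_mul (-Real.pi * b)).add (h1.const_mul (2 * Real.pi * w))).cexp
  refine h2.congr_deriv ?_
  simp only [gaussian, Pi.add_apply, Pi.pow_apply]
  push_cast
  ring

/-- The integrand is the derivative of an integrable function, so its integral over the line
vanishes. -/
theorem gaussianMoment_derivative (w : ℂ) (P : ℝ[X]) :
    hermiteScale * gaussianMoment w (derivative P - 2 * X * P) +
      2 * Real.pi * w * gaussianMoment w P = 0 := by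
  have hd : ∀ x : ℝ, HasDerivAt
      (fun x : ℝ => ((P.eval (hermiteScale * x) : ℝ) : ℂ) * gaussian 2 w x)
      (hermiteScale * ((((derivative P - 2 * X * P).eval (hermiteScale * x) : ℝ) : ℂ) *
        gaussian 2 w x) + 2 * Real.pi * w *
          (((P.eval (hermiteScale * x) : ℝ) : ℂ) * gaussian 2 w x)) x := by
    intro x
    have h1 : HasDerivAt (fun x : ℝ => P.eval (hermiteScale * x))
        ((derivative P).eval (hermiteScale * x) * hermiteScale) x := by
      have := (P.hasDerivAt (hermiteScale * x)).comp x ((hasDerivAt_id x).const_mul hermiteScale)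
      simpa using! this
    refine (h1.ofReal_comp.mul (hasDerivAt_gaussian 2 w x)).congr_deriv ?_
    simp only [eval_sub, eval_mul, eval_X, eval_ofNat]
    push_cast
    linear_combination (2 * x * ((P.eval (hermiteScale * x) : ℝ) : ℂ) * gaussian 2 w x) *
      hermiteScale_sq_complex
  have i1 := (integrable_polynomial_mul_gaussian (derivative P - 2 * X * P) w).const_mul
    (hermiteScale : ℂ)
  have i2 := (integrable_polynomial_mul_gaussian P w).const_mul (2 * Real.pi * w)
  have h := integral_eq_zero_of_hasDerivAt_of_integrable hd (i1.add i2)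
    (integrable_polynomial_mul_gaussian P w)
  rw [integral_add i1 i2, integral_const_mul, integral_const_mul] at h
  exact h

/-- Since `hermiteH (n + 1)` is `2y - d/dy` applied to `hermiteH n`, integration by parts moves the
derivative to `Q`; the linear exponent contributes the term in `w`. Taking `Q = 1` gives
coherent-state coefficients, and `w = 0` gives orthogonality. -/
theorem gaussianMoment_hermiteH_succ_mul (w : ℂ) (n : ℕ) (Q : ℝ[X]) :
    gaussianMoment w (hermiteH (n + 1) * Q) =
      gaussianMoment w (hermiteH n * derivative Q) +
        hermiteScale * w * gaussianMoment w (hermiteH n * Q) := by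
  have h := gaussianMoment_derivative w (hermiteH n * Q)
  rw [show derivative (hermiteH n * Q) - 2 * X * (hermiteH n * Q) =
    hermiteH n * derivative Q - hermiteH (n + 1) * Q by
      rw [hermiteH_succ_eq, derivative_mul]; ring, map_sub] at h
  have hc : (hermiteScale : ℂ) ≠ 0 := by exact_mod_cast hermiteScale_pos.ne'
  refine mul_left_cancel₀ hc ?_
  linear_combination -h + w * gaussianMoment w (hermiteH n * Q) * (-hermiteScale_sq_complex)

theorem gaussianMoment_one (w : ℂ) :
    gaussianMoment w 1 = (Real.sqrt 2)⁻¹ * Complex.exp (Real.pi * w ^ 2 / 2) := by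
  rw [gaussianMoment_apply]
  simp only [eval_one, Complex.ofReal_one, one_mul]
  rw [integral_gaussian_quadratic (by simp), Real.sqrt_eq_rpow,
    Complex.ofReal_inv, Complex.ofReal_cpow (by norm_num)]
  norm_num

theorem gaussianMoment_hermiteH (w : ℂ) (n : ℕ) :
    gaussianMoment w (hermiteH n) = (hermiteScale * w) ^ n * gaussianMoment w 1 := by
  induction n with
  | zero => simp [hermiteH]
  | succ n ih =>
    have h := gaussianMoment_hermiteH_succ_mul w n 1
    rw [derivative_one, mul_zero, map_zero, mul_one, mul_one, zero_add, ih] at h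
    rw [h]
    ring

theorem gaussianMoment_hermiteH_mul_hermiteH (n m : ℕ) :
    gaussianMoment 0 (hermiteH n * hermiteH m) =
      if n = m then ((2 ^ n * n.factorial * (Real.sqrt 2)⁻¹ : ℝ) : ℂ) else 0 := by
  induction n generalizing m with
  | zero =>
    rw [show hermiteH 0 = 1 from rfl, one_mul, gaussianMoment_hermiteH, gaussianMoment_one]
    cases m <;> simp
  | succ n ih =>
    rw [gaussianMoment_hermiteH_succ_mul, mul_zero, zero_mul, add_zero]
    cases m with
    | zero => simp [hermiteH]
    | succ m =>
      rw [(derivative_hermiteH_succ m).1, ← smul_eq_C_mul, mul_smul_comm, map_smul, ih]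
      by_cases h : n = m
      · subst h
        simp only [if_true, Complex.real_smul, Nat.factorial_succ]
        push_cast
        ring
      · simp [h]

end

/-! ### Fock states: orthonormality, coherent-state coefficients, completeness. -/

noncomputable section

/-- The normalisation constant of the `n`-th Fock wave function. -/
def fockCoeff (n : ℕ) : ℝ :=
  Real.sqrt hermiteScale * (Real.sqrt (2 ^ n * (n.factorial : ℝ) * Real.sqrt Real.pi))⁻¹

theorem fockCoeff_sq (n : ℕ) : fockCoeff n ^ 2 = Real.sqrt 2 / (2 ^ n * n.factorial) := by
  rw [fockCoeff, mul_pow, inv_pow, Real.sq_sqrt hermiteScale_pos.le, Real.sq_sqrt (by positivity),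
    hermiteScale, Real.sqrt_mul (by norm_num)]
  have : Real.sqrt Real.pi ≠ 0 := (Real.sqrt_pos.2 Real.pi_pos).ne'
  field_simp

theorem fockWave_eq (n : ℕ) (x : ℝ) : (fockWave n x : ℂ) =
    fockCoeff n * (((hermiteH n).eval (hermiteScale * x) : ℝ) : ℂ) * gaussian 1 0 x := by
  have e : -(Real.sqrt (2 * Real.pi) * x) ^ 2 / 2 = -Real.pi * x ^ 2 := by
    rw [mul_pow, Real.sq_sqrt (by positivity)]
    ring
  rw [← ofReal_exp_neg_pi, fockWave, hermitePsi, e, fockCoeff, hermiteScale]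
  push_cast
  ring

theorem inner_fockState_gaussianState (n : ℕ) (w : ℂ) (h1 : 0 < (1 : ℂ).re) :
    inner ℂ (fockState n) (gaussianState h1 w) =
      fockCoeff n * gaussianMoment w (hermiteH n) := by
  rw [fockState, gaussianState, inner_toLp_toLp, gaussianMoment_apply, ← integral_const_mul]
  refine integral_congr_ae (Filter.Eventually.of_forall fun x => ?_)
  simp only
  rw [Complex.conj_ofReal, fockWave_eq, mul_assoc, gaussian_mul_gaussian, zero_add,
    one_add_one_eq_two, mul_assoc]

theorem inner_fockState_fockState (n m : ℕ) :
    inner ℂ (fockState n) (fockState m) = if n = m then 1 else 0 := by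
  have h : inner ℂ (fockState n) (fockState m) =
      fockCoeff n * fockCoeff m * gaussianMoment 0 (hermiteH n * hermiteH m) := by
    rw [fockState, fockState, inner_toLp_toLp, gaussianMoment_apply, ← integral_const_mul]
    refine integral_congr_ae (Filter.Eventually.of_forall fun x => ?_)
    simp only
    rw [Complex.conj_ofReal, fockWave_eq, fockWave_eq, ← one_add_one_eq_two,
      show (0 : ℂ) = 0 + 0 by simp, ← gaussian_mul_gaussian, eval_mul, Complex.ofReal_mul,
      add_zero]
    ring
  rw [h, gaussianMoment_hermiteH_mul_hermiteH]
  split_ifs with hnm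
  · subst hnm
    norm_cast
    rw [← sq, fockCoeff_sq]
    field_simp
    push_cast
    rfl
  · rw [mul_zero]

theorem orthonormal_fockState : Orthonormal ℂ fockState :=
  orthonormal_iff_ite.2 inner_fockState_fockState

/-- The prefactor `exp(-πw²/2)` of the coherent state cancels the zeroth moment, leaving a pure
monomial in `w`. -/
theorem inner_fockState_coherentState (n : ℕ) (w : ℂ) :
    inner ℂ (fockState n) (coherentState w) =
      fockCoeff n * (hermiteScale * w) ^ n * ((Real.sqrt 2)⁻¹ : ℝ) := by
  rw [coherentState, inner_smul_right, inner_fockState_gaussianState, gaussianMoment_hermiteH,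
    gaussianMoment_one, Complex.exp_neg]
  have := Complex.exp_ne_zero (Real.pi * w ^ 2 / 2)
  push_cast
  field_simp

theorem inner_fockState_coherentState_mul (n : ℕ) (u w : ℂ) :
    inner ℂ (fockState n) (coherentState (u * w)) =
      u ^ n * inner ℂ (fockState n) (coherentState w) := by
  rw [inner_fockState_coherentState, inner_fockState_coherentState]
  ring

theorem norm_sq_inner_fockState_coherentState (n : ℕ) (w : ℂ) :
    ‖inner ℂ (fockState n) (coherentState w)‖ ^ 2 =
      (Real.sqrt 2)⁻¹ * ((Real.pi * ‖w‖ ^ 2) ^ n / n.factorial) := by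
  rw [inner_fockState_coherentState, norm_mul, norm_mul, norm_pow, norm_mul, mul_pow, mul_pow,
    Complex.norm_real, Complex.norm_real, Complex.norm_real, Real.norm_eq_abs, Real.norm_eq_abs,
    Real.norm_eq_abs, sq_abs, sq_abs, fockCoeff_sq, ← pow_mul, mul_comm n 2, pow_mul, mul_pow,
    sq_abs, hermiteScale_sq, mul_assoc 2, mul_pow 2]
  have h2 : Real.sqrt 2 ≠ 0 := by positivity
  field_simp

/-- An imaginary linear term does not change the modulus of the Gaussian, so only the prefactor
depends on `v`. -/
theorem norm_sq_coherentState_imaginary (v : ℝ) :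
    ‖coherentState (Complex.I * v)‖ ^ 2 = (Real.sqrt 2)⁻¹ * Real.exp (Real.pi * v ^ 2) := by
  have hg : ‖gaussianState (b := 1) (by simp) (Complex.I * v)‖ ^ 2 = (Real.sqrt 2)⁻¹ := by
    have h := inner_self_eq_norm_sq_to_K (𝕜 := ℂ)
      (gaussianState (b := 1) (by simp) (Complex.I * v))
    have h1 : inner ℂ (gaussianState (b := 1) (by simp) (Complex.I * v))
        (gaussianState (b := 1) (by simp) (Complex.I * v)) = gaussianMoment 0 1 := by
      rw [gaussianState, inner_toLp_toLp, gaussianMoment_apply]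
      refine integral_congr_ae (Filter.Eventually.of_forall fun x => ?_)
      simp only [conj_gaussian, gaussian_mul_gaussian, eval_one, Complex.ofReal_one, one_mul]
      simp [one_add_one_eq_two]
    rw [h1, gaussianMoment_one] at h
    simp only [ne_eq, OfNat.ofNat_ne_zero, not_false_eq_true, zero_pow, mul_zero, zero_div,
      Complex.exp_zero, mul_one] at h
    have h' := h.symm
    simp only [Complex.coe_algebraMap] at h'
    exact_mod_cast h'
  rw [coherentState, norm_smul, mul_pow, hg, Complex.norm_exp, ← Real.exp_nat_mul, mul_comm]
  congr 2
  rw [show -(Real.pi * (Complex.I * v) ^ 2 / 2) = ((Real.pi * v ^ 2 / 2 : ℝ) : ℂ) by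
    push_cast
    linear_combination (-(Real.pi * v ^ 2 / 2 : ℂ)) * Complex.I_sq, Complex.ofReal_re]
  push_cast
  ring

/-- Up to a nonzero factor the inner product is the Fourier transform of `gaussian 1 0 * φ` at `v`.
Its vanishing kills the product, and the Gaussian has no zeros. -/
theorem eq_zero_of_inner_coherentState_eq_zero {φ : Wire}
    (h : ∀ v : ℝ, inner ℂ (coherentState (Complex.I * v)) φ = 0) : φ = 0 := by
  have hg := memLp_gaussian (b := 1) (by simp) 0
  have hi : Integrable fun x => gaussian 1 0 x * φ x := hg.integrable_mul (Lp.memLp φ)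
  have hn : ∀ x, ‖gaussian 1 0 x‖ ≤ 1 := fun x => by
    rw [← ofReal_exp_neg_pi, Complex.norm_real, Real.norm_eq_abs, Real.abs_exp, Real.exp_le_one_iff]
    have := Real.pi_pos
    nlinarith [mul_nonneg this.le (sq_nonneg x)]
  have h2 : MemLp (fun x => gaussian 1 0 x * φ x) 2 volume := by
    refine (Lp.memLp φ).of_le
      ((continuous_gaussian 1 0).aestronglyMeasurable.mul (Lp.aestronglyMeasurable φ))
      (Filter.Eventually.of_forall fun x => ?_)
    rw [norm_mul]
    exact mul_le_of_le_one_left (norm_nonneg _) (hn x)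
  have hF : 𝓕 (fun x => gaussian 1 0 x * φ x) = 0 := by
    funext v
    have hv := h v
    rw [coherentState, inner_smul_left, mul_eq_zero, or_iff_right (by
      rw [← Complex.exp_conj]; exact Complex.exp_ne_zero _), L2.inner_def] at hv
    refine Eq.trans ?_ hv
    rw [Real.fourier_eq']
    refine integral_congr_ae ?_
    filter_upwards [(memLp_gaussian (b := 1) (by simp) (Complex.I * v)).coeFn_toLp] with x hx
    rw [gaussianState, hx, RCLike.inner_apply (𝕜 := ℂ), conj_gaussian, smul_eq_mul, mul_comm (φ x),
      ← mul_assoc]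
    congr 1
    rw [gaussian, gaussian, ← Complex.exp_add]
    congr 1
    simp
    ring
  have hm : MemLp (𝓕 fun x => gaussian 1 0 x * φ x) 2 volume := by
    rw [hF]
    exact MemLp.zero
  have hz : Lp.fourierTransformₗᵢ ℝ ℂ (h2.toLp _) = 0 := by
    rw [toLp_fourier_of_integrable hi h2 hm]
    exact (MemLp.toLp_congr hm MemLp.zero (Filter.EventuallyEq.of_eq hF)).trans (MemLp.toLp_zero _)
  rw [LinearIsometryEquiv.map_eq_zero_iff, Lp.eq_zero_iff_ae_eq_zero] at hz
  rw [Lp.eq_zero_iff_ae_eq_zero]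
  filter_upwards [hz, h2.coeFn_toLp] with x hx hx'
  exact (mul_eq_zero.1 (hx'.symm.trans hx)).resolve_left (Complex.exp_ne_zero _)

/-- Parseval holds with equality: the squared coefficients form the exponential series for the
squared norm, so the Fock partial sums converge to the state. -/
theorem coherentState_imaginary_mem_closure (v : ℝ) :
    coherentState (Complex.I * v) ∈ (Submodule.span ℂ (Set.range fockState)).topologicalClosure := by
  set S := (Submodule.span ℂ (Set.range fockState)).topologicalClosure
  set ξ := coherentState (Complex.I * v)
  have hbasis : ∀ n, fockState n ∈ S := fun n =>
    Submodule.le_topologicalClosure _ (Submodule.subset_span ⟨n, rfl⟩)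
  have hmem : ∀ s : Finset ℕ, ∑ n ∈ s, inner ℂ (fockState n) ξ • fockState n ∈ S := fun s =>
    Submodule.sum_mem _ fun n _ => Submodule.smul_mem _ _ (hbasis n)
  -- Pythagoras: the remainder is orthogonal to the partial sum.
  have hnorm : ∀ s : Finset ℕ, ‖ξ - ∑ n ∈ s, inner ℂ (fockState n) ξ • fockState n‖ ^ 2 =
      ‖ξ‖ ^ 2 - ∑ n ∈ s, ‖inner ℂ (fockState n) ξ‖ ^ 2 := fun s => by
    have h0 : inner ℂ (∑ n ∈ s, inner ℂ (fockState n) ξ • fockState n)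
        (ξ - ∑ n ∈ s, inner ℂ (fockState n) ξ • fockState n) = 0 := by
      rw [sum_inner]
      refine Finset.sum_eq_zero fun n hn => ?_
      rw [inner_smul_left, inner_sub_right, orthonormal_fockState.inner_right_sum _ hn, sub_self,
        mul_zero]
    have h1 := norm_add_sq_eq_norm_sq_add_norm_sq_of_inner_eq_zero _ _ h0
    rw [add_sub_cancel] at h1
    have h2 : ‖∑ n ∈ s, inner ℂ (fockState n) ξ • fockState n‖ ^ 2 =
        ∑ n ∈ s, ‖inner ℂ (fockState n) ξ‖ ^ 2 := by
      have := inner_self_eq_norm_sq_to_K (𝕜 := ℂ)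
        (∑ n ∈ s, inner ℂ (fockState n) ξ • fockState n)
      rw [orthonormal_fockState.inner_sum] at this
      simp only [Complex.conj_mul', Complex.coe_algebraMap] at this
      exact_mod_cast this.symm
    rw [← h2]
    linarith
  have hsum : HasSum (fun n => ‖inner ℂ (fockState n) ξ‖ ^ 2) (‖ξ‖ ^ 2) := by
    rw [norm_sq_coherentState_imaginary]
    simp only [ξ, norm_sq_inner_fockState_coherentState, norm_mul, Complex.norm_I, one_mul,
      Complex.norm_real, Real.norm_eq_abs, sq_abs]
    rw [Real.exp_eq_exp_ℝ]
    exact (NormedSpace.expSeries_div_hasSum_exp (Real.pi * v ^ 2)).mul_left _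
  have hlim : Filter.Tendsto (fun s : Finset ℕ =>
      ‖ξ - ∑ n ∈ s, inner ℂ (fockState n) ξ • fockState n‖ ^ 2) Filter.atTop (nhds 0) := by
    simp only [hnorm]
    have := (tendsto_const_nhds (x := ‖ξ‖ ^ 2)).sub hsum
    rwa [sub_self] at this
  have hlim2 : Filter.Tendsto (fun s : Finset ℕ =>
      ∑ n ∈ s, inner ℂ (fockState n) ξ • fockState n) Filter.atTop (nhds ξ) := by
    rw [tendsto_iff_norm_sub_tendsto_zero]
    have := hlim.sqrt
    simp only [Real.sqrt_sq (norm_nonneg _), Real.sqrt_zero] at this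
    simpa only [norm_sub_rev] using this
  exact (Submodule.isClosed_topologicalClosure _).mem_of_tendsto hlim2
    (Filter.Eventually.of_forall hmem)

/-- The Fock states as a Hilbert basis of `L²(ℝ)`. -/
def fockBasis : HilbertBasis ℕ ℂ Wire :=
  HilbertBasis.mkOfOrthogonalEqBot orthonormal_fockState (by
    rw [← Submodule.orthogonal_closure, Submodule.eq_bot_iff]
    exact fun φ hφ => eq_zero_of_inner_coherentState_eq_zero fun v =>
      hφ _ (coherentState_imaginary_mem_closure v))

theorem fockBasis_apply (n : ℕ) : fockBasis n = fockState n :=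
  congrFun (HilbertBasis.coe_mkOfOrthogonalEqBot _ _) n

end

/-! ### The Euler rule. -/

theorem ext_of_coherentState {T S : Wire →L[ℂ] ℂ}
    (h : ∀ v : ℝ, T (coherentState (Complex.I * v)) = S (coherentState (Complex.I * v))) :
    T = S := by
  have hd : Dense ((Submodule.span ℂ (Set.range fun v : ℝ => coherentState (Complex.I * v)) :
      Submodule ℂ Wire) : Set Wire) := by
    rw [Submodule.dense_iff_topologicalClosure_eq_top,
      Submodule.topologicalClosure_eq_top_iff, Submodule.eq_bot_iff]
    exact fun φ hφ => eq_zero_of_inner_coherentState_eq_zero fun v =>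
      hφ _ (Submodule.subset_span ⟨v, rfl⟩)
  exact ContinuousLinearMap.ext_on hd (by rintro _ ⟨v, rfl⟩; exact h v)

/-- Both sides are bounded linear functionals of `φ`, so coherent states suffice. -/
theorem inner_fockState_zxzCLM {θ : ℝ} (hθ : θ ∈ Set.Ioo (-Real.pi) Real.pi) (n : ℕ)
    (φ : Wire) :
    inner ℂ (fockState n) (Complex.exp (-(Complex.I * θ / 2)) •
      zxzCLM (Real.tan (θ / 2)) (Real.sin θ) (Real.tan (θ / 2)) φ) =
      Complex.exp (Complex.I * θ * n) * inner ℂ (fockState n) φ := by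
  have h : (innerSL ℂ (fockState n)) ∘L (Complex.exp (-(Complex.I * θ / 2)) •
      zxzCLM (Real.tan (θ / 2)) (Real.sin θ) (Real.tan (θ / 2))) =
      Complex.exp (Complex.I * θ * n) • innerSL ℂ (fockState n) := by
    refine ext_of_coherentState fun v => ?_
    rw [ContinuousLinearMap.comp_apply, smul_apply,
      smul_apply, innerSL_apply_apply, innerSL_apply_apply,
      zxzCLM_coherentState hθ, smul_smul, ← Complex.exp_add, neg_add_cancel, Complex.exp_zero,
      one_smul, inner_fockState_coherentState_mul, ← Complex.exp_nat_mul, smul_eq_mul]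
    congr 2
    ring
  exact DFunLike.congr_fun h φ

theorem hasSum_zxzCLM {θ : ℝ} (hθ : θ ∈ Set.Ioo (-Real.pi) Real.pi) (φ : Wire) :
    HasSum (fun n : ℕ => (Complex.exp (Complex.I * θ * n) * inner ℂ (fockState n) φ) • fockState n)
      (Complex.exp (-(Complex.I * θ / 2)) •
        zxzCLM (Real.tan (θ / 2)) (Real.sin θ) (Real.tan (θ / 2)) φ) := by
  have h := fockBasis.hasSum_repr (Complex.exp (-(Complex.I * θ / 2)) •
    zxzCLM (Real.tan (θ / 2)) (Real.sin θ) (Real.tan (θ / 2)) φ)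
  simpa only [HilbertBasis.repr_apply_apply, fockBasis_apply, inner_fockState_zxzCLM hθ] using h

theorem phaseRotation_neg_eq {θ : ℝ} (hθ : θ ∈ Set.Ioo (-Real.pi) Real.pi) :
    phaseRotation (-θ) = Complex.exp (-(Complex.I * θ / 2)) •
      zxzComposite (Real.tan (θ / 2)) (Real.sin θ) (Real.tan (θ / 2)) := by
  have hg : ∀ n : ℕ, Complex.exp (-(Complex.I * ((-θ : ℝ) : ℂ) * n)) =
      Complex.exp (Complex.I * θ * n) := fun n => by
    congr 1
    push_cast
    ring
  rw [phaseRotation]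
  simp only [hg]
  refine LinearPMap.ext ?_ ?_
  · rw [LinearPMap.smul_domain, zxzComposite_domain]
    -- The rotation series converges at every state because it is the Fock expansion of a vector
    -- already in hand.
    exact eq_top_iff.2 fun φ _ => (hasSum_zxzCLM hθ φ).summable
  · intro φ h1 h2
    rw [LinearPMap.smul_apply, zxzComposite_apply]
    exact (hasSum_zxzCLM hθ φ).tsum_eq

theorem mainTheorem10 (θ : ℝ) (hθ : θ ∈ Set.Ioo (-Real.pi) Real.pi) :
    (zxzComposite (Real.tan (θ / 2)) (Real.sin θ) (Real.tan (θ / 2))).domain = ⊤ ∧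
    phaseRotation (-θ) =
      Complex.exp (-(Complex.I * θ / 2)) •
        zxzComposite (Real.tan (θ / 2)) (Real.sin θ) (Real.tan (θ / 2)) ∧
    phaseRotation θ =
      Complex.exp (Complex.I * θ / 2) •
        zxzComposite (-Real.tan (θ / 2)) (-Real.sin θ) (-Real.tan (θ / 2)) := by
  refine ⟨zxzComposite_domain _ _ _, phaseRotation_neg_eq hθ, ?_⟩
  -- The interval is symmetric and `tan`, `sin` are odd, so the second identity is the first at
  -- `-θ`.
  have h := phaseRotation_neg_eq (θ := -θ) ⟨by linarith [hθ.2], by linarith [hθ.1]⟩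
  rw [neg_neg, neg_div, Real.tan_neg, Real.sin_neg] at h
  rw [h]
  congr 2
  push_cast
  ring
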